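/- Let $K$ be a field of characteristic $0$, let $n$ be a positive integer, and let $\mathbf{x}^{(i)}=(\mathbf{x}^{(i)}_1,\mathbf{x}^{(i)}_2,\dots)$, $i\ge 1$, be countably infinite sequences of independent variables. For $k\ge 0$ let $h_k(\mathbf{x})$ be the complete symmetric function (the sum of all monomials of degree $k$ in $\mathbf{x}_1,\mathbf{x}_2,\dots$), let $h_k=0$ for $k<0$, and let $s_\lambda(\mathbf{x})$ be the Schur function of the partition $\lambda$, whose restriction to $N\ge\ell(\lambda)$ variables is $\det(\mathbf{x}_i^{\lambda_j+N-j})_{1\le i,j\le N}/\det(\mathbf{x}_i^{N-j})_{1\le i,j\le N}$. All identities are in rings of formal power series over $K$, and infinite sums converge coefficientwise. For an array $A=(A(i_1,\dots,i_{2m}))_{1\le i_1,\dots,i_{2m}\le n}$ put $$\mathrm{hdet}_{2m}(A)=\frac1{n!}\sum_{\sigma_1,\dots,\sigma_{2m}\in S_n}\mathrm{sgn}(\sigma_1)\cdots\mathrm{sgn}(\sigma_{2m})\prod_{j=1}^n A(\sigma_1(j),\dots,\sigma_{2m}(j)).$$ For an array $B=(B(i_1,\dots,i_{2m}))_{1\le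 i_1,\dots,i_{2m}\le 2n}$ which changes sign when $i_{2s-1}$ and $i_{2s}$ are interchanged, for each $1\le s\le m$, put $$\mathrm{hpf}_{2m}(B)=\frac1{n!}\sum_{\sigma_1,\dots,\sigma_m\in E_{2n}}\mathrm{sgn}(\sigma_1)\cdots\mathrm{sgn}(\sigma_m)\prod_{j=1}^n B(\sigma_1(2j-1),\sigma_1(2j),\dots,\sigma_m(2j-1),\sigma_m(2j)),$$ where $E_{2n}=\{\sigma\in S_{2n} : \sigma(2j-1)<\sigma(2j)\text{ for }1\le j\le n\}$. Then, for each positive integer $m$, $$\sum_{\lambda:\,\ell(\lambda)\le n}s_\lambda(\mathbf{x}^{(1)})\cdots s_\lambda(\mathbf{x}^{(2m)})=\mathrm{hdet}_{2m}\Bigl(\sum_{k\ge0}h_{k-i_1}(\mathbf{x}^{(1)})h_{k-i_2}(\mathbf{x}^{(2)})\cdots h_{k-i_{2m}}(\mathbf{x}^{(2m)})\Bigr)_{1\le i_1,\dots,i_{2m}\le n}.$$ Furthermore, for each odd positive integer $m$, $$\sum_{\lambda:\,\ell(\lambda)\le 2n}s_\lambda(\mathbf{x}^{(1)})\cdots s_\lambda(\mathbf{x}^{(m)})=(-1)^n\,\mathrm{hpf}_{2m}\Bigl(\sum_{k,l\ge0}\prod_{s=1}^m\det\begin{pmatrix}h_{k+l+1-i_{2s-1}}(\mathbf{x}^{(s)})&h_{l-i_{2s-1}}(\mathbf{x}^{(s)})\\h_{k+l+1-i_{2s}}(\mathbf{x}^{(s)})&h_{l-i_{2s}}(\mathbf{x}^{(s)})\end{pmatrix}\Bigr)_{1\le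 i_1,\dots,i_{2m}\le 2n}.$$ In particular, all the infinite sums above converge and the last array is alternating in each pair $(i_{2s-1},i_{2s})$. -/

import Mathlib

open scoped MvPowerSeries.WithPiTopology

/-! ### Hyperdeterminants and hyperpfaffians -/

/-- The hyperdeterminant
`(1 / n!) ∑ sgn(σ₁) ⋯ sgn(σ₂ₘ) ∏ⱼ A(σ₁(j), …, σ₂ₘ(j))` (sum over `σ₁, …, σ₂ₘ ∈ Sₙ`)
of a `2m`-dimensional array of size `n`. The indices `1, …, n` are represented by
`0, …, n - 1` in `Fin n`. -/
noncomputable def hdet (K : Type*) [Field K] {R : Type*} [CommRing R] [Algebra K R] (m n : ℕ)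
    (A : (Fin (2 * m) → Fin n) → R) : R :=
  ((n.factorial : K)⁻¹) •
    ∑ σ : Fin (2 * m) → Equiv.Perm (Fin n),
      (∏ s, ((Equiv.Perm.sign (σ s) : ℤ) : R)) * ∏ j : Fin n, A (fun s => σ s j)

/-- The `e`-th element (`e = 0, 1`) of the `j`-th consecutive pair `(2j, 2j + 1)` in `Fin (2n)`. -/
def pairPos {n : ℕ} (j : Fin n) (e : Fin 2) : Fin (2 * n) :=
  ⟨2 * (j : ℕ) + (e : ℕ), by omega⟩

/-- The permutations of `2n` letters that are increasing on every consecutive pair. -/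
def pairIncreasing (n : ℕ) : Finset (Equiv.Perm (Fin (2 * n))) :=
  Finset.univ.filter fun σ => ∀ j : Fin n, σ (pairPos j 0) < σ (pairPos j 1)

/-- A `2m`-dimensional array of size `2n`, its indices `i₁, …, i₂ₘ` being grouped into the `m` pairs
`(i s 0, i s 1) = (i₂ₛ₋₁, i₂ₛ)`, is alternating in each pair. -/
def IsPairAlternating {R : Type*} [CommRing R] {m n : ℕ}
    (B : (Fin m → Fin 2 → Fin (2 * n)) → R) : Prop :=
  ∀ (τ : Fin m → Equiv.Perm (Fin 2)) (i : Fin m → Fin 2 → Fin (2 * n)),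
    B (fun s e => i s (τ s e)) = (∏ s, ((Equiv.Perm.sign (τ s) : ℤ) : R)) * B i

/-- The hyperpfaffian
`(1 / n!) ∑ sgn(σ₁) ⋯ sgn(σₘ) ∏ⱼ B(σ₁(2j-1), σ₁(2j), …, σₘ(2j-1), σₘ(2j))`
of a `2m`-dimensional array of size `2n` that is alternating in each pair of indices; the sum is
over permutations of `2n` letters that are increasing on every consecutive pair. -/
noncomputable def hpf (K : Type*) [Field K] {R : Type*} [CommRing R] [Algebra K R] (m n : ℕ)
    (B : (Fin m → Fin 2 → Fin (2 * n)) → R) : R :=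
  ((n.factorial : K)⁻¹) •
    ∑ σ ∈ Fintype.piFinset fun _ : Fin m => pairIncreasing n,
      (∏ s, ((Equiv.Perm.sign (σ s) : ℤ) : R)) *
        ∏ j : Fin n, B (fun s e => σ s (pairPos j e))

/-! ### Schur functions and complete symmetric functions -/

/-- The alternant `det (xᵢ ^ αⱼ)` in the variables `x₀, …, x_{N-1}`. -/
noncomputable def alternant (K : Type*) [Field K] {N : ℕ} (α : Fin N → ℕ) : MvPolynomial ℕ K :=
  Matrix.det (Matrix.of fun i j : Fin N => (MvPolynomial.X (i : ℕ) : MvPolynomial ℕ K) ^ α j)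

/-- The staircase exponents `δ = (N - 1, N - 2, …, 0)`. -/
def staircase (N : ℕ) : Fin N → ℕ := fun j => N - 1 - (j : ℕ)

theorem alternant_staircase_dvd (K : Type*) [Field K] {N : ℕ} (α : Fin N → ℕ) :
    alternant K (staircase N) ∣ alternant K α := by
  classical
  rcases Nat.eq_zero_or_pos N with rfl | hN
  · simp [alternant]
  let P : Polynomial (MvPolynomial ℕ K) :=
    ∏ i : Fin N, (Polynomial.X - Polynomial.C (MvPolynomial.X (i : ℕ)))
  have hP : P.Monic := Polynomial.monic_prod_of_monic _ _ fun i _ => Polynomial.monic_X_sub_C _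
  have hdeg : P.natDegree = N := by
    rw [Polynomial.natDegree_prod_of_monic _ _ fun i _ => Polynomial.monic_X_sub_C _]
    simp
  have hP1 : P ≠ 1 := by
    intro h
    rw [h, Polynomial.natDegree_one] at hdeg
    omega
  let r : Fin N → Polynomial (MvPolynomial ℕ K) := fun j => (Polynomial.X ^ α j) %ₘ P
  have hr : ∀ i j : Fin N, (r j).eval (MvPolynomial.X (i : ℕ)) =
      (MvPolynomial.X (i : ℕ) : MvPolynomial ℕ K) ^ α j := by
    intro i j
    have h := congrArg (Polynomial.eval (MvPolynomial.X (i : ℕ) : MvPolynomial ℕ K))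
      (Polynomial.modByMonic_add_div (Polynomial.X ^ α j) P)
    have h0 : P.eval (MvPolynomial.X (i : ℕ) : MvPolynomial ℕ K) = 0 := by
      rw [Polynomial.eval_prod]
      exact Finset.prod_eq_zero (Finset.mem_univ i) (by simp)
    simpa [h0] using h
  refine ⟨Matrix.det (Matrix.of fun k j : Fin N => (r j).coeff (staircase N k)), ?_⟩
  rw [alternant, alternant, ← Matrix.det_mul]
  congr 1
  ext1 i j
  have hlt : (r j).natDegree < N := hdeg ▸ Polynomial.natDegree_modByMonic_lt _ hP hP1
  rw [Matrix.of_apply, ← hr i j, Polynomial.eval_eq_sum_range' hlt, Finset.sum_range,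
    ← Equiv.sum_comp Fin.revPerm, Matrix.mul_apply]
  refine Finset.sum_congr rfl fun k _ => ?_
  have hk : ((Fin.revPerm k : Fin N) : ℕ) = staircase N k := by
    simp only [Fin.revPerm_apply, Fin.val_rev, staircase]
    omega
  rw [hk, Matrix.of_apply, Matrix.of_apply, mul_comm]

/-- The exponents `μ + δ = (μ₁ + N - 1, μ₂ + N - 2, …, μ_N)`. -/
def shiftedParts (N : ℕ) (μ : YoungDiagram) : Fin N → ℕ :=
  fun j => μ.rowLen j + staircase N j

/-- The Schur polynomial `s_μ(x₀, …, x_{N-1})`, that is the quotient of the alternant with exponents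
`μ + δ` by the one with exponents `δ` (it is meant for `N` at least the length of `μ`). -/
noncomputable def schurPoly (K : Type*) [Field K] (N : ℕ) (μ : YoungDiagram) : MvPolynomial ℕ K :=
  (alternant_staircase_dvd K (shiftedParts N μ)).choose

theorem schurPoly_spec (K : Type*) [Field K] (N : ℕ) (μ : YoungDiagram) :
    alternant K (shiftedParts N μ) = alternant K (staircase N) * schurPoly K N μ :=
  (alternant_staircase_dvd K (shiftedParts N μ)).choose_spec

/-- The Schur function `s_μ` in the countably many variables `x₀, x₁, …`: the coefficient of the
monomial `x ^ d` is its coefficient in the Schur polynomial `s_μ(x₀, …, x_{N-1})`, where `N` is at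
least the length of `μ` and large enough for all the variables of `x ^ d` to occur. -/
noncomputable def schurFunction (K : Type*) [Field K] (μ : YoungDiagram) : MvPowerSeries ℕ K :=
  fun d => (schurPoly K (max (μ.colLen 0) (d.support.sup (· + 1))) μ).coeff d

/-- The complete symmetric function `h_k` in the countably many variables `x₀, x₁, …`, the sum of
all monomials of degree `k`; it is `0` for `k < 0`. -/
noncomputable def completeFunction (K : Type*) [Field K] (k : ℤ) : MvPowerSeries ℕ K :=
  fun d => if (d.degree : ℤ) = k then 1 else 0

/-- `f(x^{(s)})` for a power series `f` in countably many variables: substitution of the `s`-th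
alphabet `x^{(s)} = (x_{(s,0)}, x_{(s,1)}, …)`. -/
noncomputable def inAlphabet {K : Type*} [Field K] {r : ℕ} (s : Fin r) (f : MvPowerSeries ℕ K) :
    MvPowerSeries (Fin r × ℕ) K :=
  MvPowerSeries.rename (Function.Embedding.sectR s ℕ) f

/-- `h_k(x^{(s)})`. -/
noncomputable def hIn (K : Type*) [Field K] {r : ℕ} (s : Fin r) (k : ℤ) :
    MvPowerSeries (Fin r × ℕ) K :=
  inAlphabet s (completeFunction K k)

/-- The partitions of length at most `n`. -/
abbrev PartitionOfLengthLE (n : ℕ) : Type := {μ : YoungDiagram // μ.colLen 0 ≤ n}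

/-- The `k`-th term `h_{k-i₁}(x^{(1)}) ⋯ h_{k-i₂ₘ}(x^{(2m)})` of the array of the even formula.
The index `i₁ ∈ {1, …, n}` is represented by `i₁ - 1` in `Fin n`, and likewise for the others. -/
noncomputable def evenTerm (K : Type*) [Field K] {m n : ℕ} (i : Fin (2 * m) → Fin n) (k : ℕ) :
    MvPowerSeries (Fin (2 * m) × ℕ) K :=
  ∏ s : Fin (2 * m), hIn K s ((k : ℤ) - ((i s : ℕ) + 1))

/-- The term indexed by `(k, l)` of the array of the odd formula: the product over `s` of
`det !![h_{k+l+1-a}, h_{l-a}; h_{k+l+1-b}, h_{l-b}]` in the variables `x^{(s)}`, where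
`(a, b) = (i₂ₛ₋₁, i₂ₛ)` is represented by `(a - 1, b - 1)` in `Fin (2n)`. -/
noncomputable def oddTerm (K : Type*) [Field K] {m n : ℕ} (i : Fin m → Fin 2 → Fin (2 * n))
    (p : ℕ × ℕ) : MvPowerSeries (Fin m × ℕ) K :=
  ∏ s : Fin m, Matrix.det
    !![hIn K s ((p.1 : ℤ) + p.2 + 1 - ((i s 0 : ℕ) + 1)), hIn K s ((p.2 : ℤ) - ((i s 0 : ℕ) + 1));
       hIn K s ((p.1 : ℤ) + p.2 + 1 - ((i s 1 : ℕ) + 1)), hIn K s ((p.2 : ℤ) - ((i s 1 : ℕ) + 1))]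

/-!
Both formulas come from the Jacobi–Trudi formula and an expansion of products of infinite sums.

Put `D_s(v) = det (h_{v_j - i}(x^{(s)}))` for a sequence `v` of natural numbers (`completeDet`). It is
alternating in `v`, vanishes if some `v_j` is `0`, and by the Jacobi–Trudi formula
(`schurFunction_eq_jacobiTrudi`) it is `± s_μ(x^{(s)})` when `v` is the sequence
`μ_j + n - j + 1`; the sign is that of the reversal of `n` letters. As `μ` runs over the partitions
of length at most `n`, these sequences and their rearrangements are exactly the sequences of pairwise
distinct positive numbers, each occurring once (`HasSum.arrangedParts`).

Expanding the `n`-fold products of series in the hyperdeterminant, and summing over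
`σ₁, …, σ₂ₘ` first, turns it into `(1 / n!) ∑_v ∏_s D_s(v)` (`hasSum_hdet`). An even number of factors
makes every summand symmetric in `v` and removes the sign, so each `μ` is counted `n!` times.

In the hyperpfaffian the sum over one `σ_s` is the Laplace expansion of `D_s(v)` along pairs of
consecutive columns (`sum_pairIncreasing_prod_det`), where `v` is the sequence
`(k₁ + l₁ + 1, l₁, …, k_n + l_n + 1, l_n)`. So the hyperpfaffian is `(1 / n!) ∑_v ∏_s D_s(v)` over the
sequences `v` of length `2n` that decrease on every consecutive pair (`hasSum_hpf`). With an odd number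
of factors, the partition `μ` contributes its product of Schur functions times
`(1 / n!) ∑ sgn(π)` over the permutations `π` increasing on every consecutive pair, which is `1`
(`sum_sign_pairIncreasing`), and times the sign `(-1)^n` of the reversal of `2n` letters.

The Jacobi–Trudi formula in `N` variables is `H(t) ∏_{i ≠ r} (1 - xᵢ t) = 1 / (1 - x_r t)` written as
an identity of matrices (`coe_alternant`): every alternant is a determinant that does not depend on
its exponents times a determinant of complete symmetric functions, and the latter is `1` for the
staircase exponents. The products of series may be expanded because power series over a discrete
field form a nonarchimedean ring.
-/

open Equiv

/-! ### Permutations and consecutive pairs -/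

theorem pairPos_injective2 {n : ℕ} : Function.Injective2 (pairPos (n := n)) := by
  intro j j' e e' h
  simp only [pairPos, Fin.mk.injEq] at h
  constructor <;> ext <;> omega

/-- The positions `0, …, 2n - 1` as pairs (number of the consecutive pair, place in it). -/
def pairEquiv (n : ℕ) : Fin n × Fin 2 ≃ Fin (2 * n) where
  toFun p := pairPos p.1 p.2
  invFun c := (⟨c / 2, by omega⟩, ⟨c % 2, by omega⟩)
  left_inv p := by
    obtain ⟨j, e⟩ := p
    ext <;> simp only [pairPos] <;> omega
  right_inv c := by
    ext
    simp only [pairPos]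
    omega

@[simp] theorem pairEquiv_apply {n : ℕ} (p : Fin n × Fin 2) :
    pairEquiv n p = pairPos p.1 p.2 := rfl

@[simp] theorem pairEquiv_symm_pairPos {n : ℕ} (j : Fin n) (e : Fin 2) :
    (pairEquiv n).symm (pairPos j e) = (j, e) :=
  (pairEquiv n).symm_apply_apply (j, e)

theorem exists_eq_pairPos {n : ℕ} (c : Fin (2 * n)) : ∃ j e, c = pairPos j e :=
  ⟨_, _, ((pairEquiv n).apply_symm_apply c).symm⟩

theorem mem_pairIncreasing {n : ℕ} {σ : Perm (Fin (2 * n))} :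
    σ ∈ pairIncreasing n ↔ ∀ j : Fin n, σ (pairPos j 0) < σ (pairPos j 1) := by
  simp [pairIncreasing]

/-- The permutation of `2n` letters that acts on the `j`-th consecutive pair by `ε j`. -/
def withinPairs {n : ℕ} (ε : Fin n → Perm (Fin 2)) : Perm (Fin (2 * n)) :=
  (pairEquiv n).permCongr (prodCongrRight ε)

theorem withinPairs_pairPos {n : ℕ} (ε : Fin n → Perm (Fin 2)) (j : Fin n) (e : Fin 2) :
    withinPairs ε (pairPos j e) = pairPos j (ε j e) := by
  simp [withinPairs, permCongr_apply]

theorem sign_withinPairs {n : ℕ} (ε : Fin n → Perm (Fin 2)) :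
    Perm.sign (withinPairs ε) = ∏ j, Perm.sign (ε j) := by
  rw [withinPairs, Perm.sign_permCongr, Perm.sign_prodCongrRight]

/-- The permutation of `2n` letters that moves the `n` consecutive pairs by `π`. -/
def ofPairs {n : ℕ} (π : Perm (Fin n)) : Perm (Fin (2 * n)) :=
  (pairEquiv n).permCongr (prodCongrLeft fun _ => π)

theorem ofPairs_pairPos {n : ℕ} (π : Perm (Fin n)) (j : Fin n) (e : Fin 2) :
    ofPairs π (pairPos j e) = pairPos (π j) e := by
  simp [ofPairs, permCongr_apply]

theorem sign_ofPairs {n : ℕ} (π : Perm (Fin n)) : Perm.sign (ofPairs π) = 1 := by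
  rw [ofPairs, Perm.sign_permCongr, Perm.sign_prodCongrLeft]
  simp [Int.units_sq]

theorem sum_perm_fin_two {M : Type*} [AddCommMonoid M] (f : Perm (Fin 2) → M) :
    ∑ ε, f ε = f 1 + f (swap 0 1) := by
  have : (Finset.univ : Finset (Perm (Fin 2))) = {1, swap 0 1} := by decide
  rw [this, Finset.sum_pair (by decide)]

/-- Every permutation becomes increasing on all the consecutive pairs after exactly one choice of
permutations within the pairs. -/
theorem card_withinPairs_mem_pairIncreasing {n : ℕ} (σ : Perm (Fin (2 * n))) :
    ∑ ε : Fin n → Perm (Fin 2),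
      (if σ * (withinPairs ε)⁻¹ ∈ pairIncreasing n then 1 else 0 : ℕ) = 1 := by
  have hinv : ∀ (ε : Fin n → Perm (Fin 2)) j e,
      (withinPairs ε)⁻¹ (pairPos j e) = pairPos j ((ε j)⁻¹ e) := by
    intro ε j e
    rw [Perm.inv_eq_iff_eq, withinPairs_pairPos, ← Perm.mul_apply, mul_inv_cancel, Perm.one_apply]
  calc _ = ∑ ε : Fin n → Perm (Fin 2), ∏ j,
        (if σ (pairPos j ((ε j)⁻¹ 0)) < σ (pairPos j ((ε j)⁻¹ 1)) then 1 else 0 : ℕ) := by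
        refine Finset.sum_congr rfl fun ε _ => ?_
        rw [Finset.prod_ite_zero]
        simp only [mem_pairIncreasing, Perm.mul_apply, hinv, Finset.mem_univ, true_implies,
          Finset.prod_const_one]
    _ = ∏ j, ∑ ε : Perm (Fin 2),
        (if σ (pairPos j (ε⁻¹ 0)) < σ (pairPos j (ε⁻¹ 1)) then 1 else 0 : ℕ) := by
        rw [Finset.prod_univ_sum]
        simp
    _ = 1 := by
        refine Finset.prod_eq_one fun j _ => ?_
        rw [sum_perm_fin_two]
        have hne : σ (pairPos j 0) ≠ σ (pairPos j 1) := fun h =>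
          absurd (pairPos_injective2 (σ.injective h)).2 (by decide)
        simp only [inv_one, Perm.one_apply, swap_inv, swap_apply_left, swap_apply_right]
        rcases lt_or_gt_of_ne hne with h | h
        · simp [h, h.le]
        · simp [h, h.le]

/-- Laplace expansion of a determinant of size `2n` along the `n` pairs of consecutive columns. -/
theorem sum_pairIncreasing_prod_det {R : Type*} [CommRing R] {n : ℕ}
    (M : Matrix (Fin (2 * n)) (Fin (2 * n)) R) :
    ∑ σ ∈ pairIncreasing n, ((Perm.sign σ : ℤ) : R) *
        ∏ j : Fin n, Matrix.det (Matrix.of fun a b : Fin 2 => M (σ (pairPos j a)) (pairPos j b)) =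
      M.det := by
  set F : Perm (Fin (2 * n)) → R := fun σ => ((Perm.sign σ : ℤ) : R) * ∏ c, M (σ c) c with hF
  have h1 : ∀ σ : Perm (Fin (2 * n)), ((Perm.sign σ : ℤ) : R) *
        ∏ j : Fin n, Matrix.det (Matrix.of fun a b : Fin 2 => M (σ (pairPos j a)) (pairPos j b)) =
      ∑ ε : Fin n → Perm (Fin 2), F (σ * withinPairs ε) := by
    intro σ
    simp only [Matrix.det_apply', Finset.prod_univ_sum, Finset.mul_sum]
    rw [Fintype.piFinset_univ]
    refine Finset.sum_congr rfl fun ε _ => ?_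
    rw [hF]
    simp only [Perm.sign_mul, sign_withinPairs]
    rw [Finset.prod_mul_distrib, ← mul_assoc, ← (pairEquiv n).prod_comp, Fintype.prod_prod_type]
    simp [withinPairs_pairPos]
  simp only [h1]
  calc ∑ σ ∈ pairIncreasing n, ∑ ε : Fin n → Perm (Fin 2), F (σ * withinPairs ε)
      = ∑ ε : Fin n → Perm (Fin 2), ∑ σ,
          if σ ∈ pairIncreasing n then F (σ * withinPairs ε) else 0 := by
        rw [Finset.sum_comm]
        simp [Finset.sum_ite_mem]
    _ = ∑ ε : Fin n → Perm (Fin 2), ∑ σ,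
          if σ * (withinPairs ε)⁻¹ ∈ pairIncreasing n then F σ else 0 := by
        refine Finset.sum_congr rfl fun ε _ => ?_
        rw [← Equiv.sum_comp (Equiv.mulRight (withinPairs ε)) fun σ =>
          if σ * (withinPairs ε)⁻¹ ∈ pairIncreasing n then F σ else 0]
        simp only [coe_mulRight, mul_inv_cancel_right]
    _ = ∑ σ, F σ * ((∑ ε : Fin n → Perm (Fin 2),
          (if σ * (withinPairs ε)⁻¹ ∈ pairIncreasing n then 1 else 0 : ℕ) : ℕ) : R) := by
        rw [Finset.sum_comm]
        refine Finset.sum_congr rfl fun σ _ => ?_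
        push_cast
        rw [Finset.mul_sum]
        simp only [mul_ite, mul_one, mul_zero]
    _ = M.det := by
        simp only [card_withinPairs_mem_pairIncreasing, Nat.cast_one, mul_one, hF,
          Matrix.det_apply']

/-- The letters `2t, 2t + 1` occupy one consecutive pair of positions of the word of `σ`. -/
def KeepsPair {n : ℕ} (σ : Perm (Fin (2 * n))) (t : Fin n) : Prop :=
  ((pairEquiv n).symm (σ⁻¹ (pairPos t 0))).1 = ((pairEquiv n).symm (σ⁻¹ (pairPos t 1))).1

/-- The transposition of the letters `2t` and `2t + 1`. -/
def swapPair {n : ℕ} (t : Fin n) : Perm (Fin (2 * n)) := swap (pairPos t 0) (pairPos t 1)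

theorem keepsPair_swapPair_mul {n : ℕ} (σ : Perm (Fin (2 * n))) (t t' : Fin n) :
    KeepsPair (swapPair t * σ) t' ↔ KeepsPair σ t' := by
  unfold KeepsPair
  rw [mul_inv_rev, swapPair, swap_inv, Perm.mul_apply, Perm.mul_apply]
  by_cases h : t' = t
  · subst h
    rw [swap_apply_left, swap_apply_right, eq_comm]
  · have h' : ∀ e e', pairPos t' e ≠ pairPos t e' := fun e e' he => h (pairPos_injective2 he).1
    rw [swap_apply_of_ne_of_ne (h' _ _) (h' _ _), swap_apply_of_ne_of_ne (h' _ _) (h' _ _)]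

theorem swapPair_mul_mem_pairIncreasing {n : ℕ} {σ : Perm (Fin (2 * n))} {t : Fin n}
    (hσ : σ ∈ pairIncreasing n) (ht : ¬ KeepsPair σ t) :
    swapPair t * σ ∈ pairIncreasing n := by
  rw [mem_pairIncreasing] at hσ ⊢
  intro j
  have hj := hσ j
  -- `2t` and `2t + 1` are adjacent letters, so their exchange keeps the order of any other pair
  have hne : ¬ (σ (pairPos j 0) = pairPos t 0 ∧ σ (pairPos j 1) = pairPos t 1) := by
    rintro ⟨h0, h1⟩
    apply ht
    rw [KeepsPair, ← h0, ← h1]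
    simp only [← Perm.mul_apply, inv_mul_cancel, Perm.one_apply, pairEquiv_symm_pairPos]
  rw [Perm.mul_apply, Perm.mul_apply, swapPair, swap_apply_def, swap_apply_def]
  generalize σ (pairPos j 0) = a at *
  generalize σ (pairPos j 1) = b at *
  simp only [Fin.ext_iff, Fin.lt_def, pairPos] at hj hne ⊢
  split_ifs <;> simp <;> omega

theorem exists_ofPairs_eq {n : ℕ} {σ : Perm (Fin (2 * n))}
    (hσ : σ ∈ pairIncreasing n) (h : ∀ t, KeepsPair σ t) : ∃ π, ofPairs π = σ := by
  rw [mem_pairIncreasing] at hσ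
  have key : ∀ j, ∃ t, ∀ e, σ (pairPos j e) = pairPos t e := by
    intro j
    obtain ⟨t, e, hte⟩ := exists_eq_pairPos (σ (pairPos j 0))
    obtain ⟨j₀, e₀, h₀⟩ := exists_eq_pairPos (σ⁻¹ (pairPos t 0))
    obtain ⟨j₁, e₁, h₁⟩ := exists_eq_pairPos (σ⁻¹ (pairPos t 1))
    have hj := h t
    rw [KeepsPair, h₀, h₁, pairEquiv_symm_pairPos, pairEquiv_symm_pairPos] at hj
    simp only at hj
    subst hj
    rw [Perm.inv_eq_iff_eq] at h₀ h₁
    have hlt := hσ j₀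
    have hne : e₀ ≠ e₁ := by
      rintro rfl
      exact absurd (pairPos_injective2 (h₀.trans h₁.symm)).2 (by decide)
    have hjj : j = j₀ := by
      fin_cases e
      · exact (pairPos_injective2 (σ.injective (hte.trans h₀))).1
      · exact (pairPos_injective2 (σ.injective (hte.trans h₁))).1
    subst hjj
    refine ⟨t, ?_⟩
    fin_cases e₀ <;> fin_cases e₁
    · exact absurd rfl hne
    · intro e
      fin_cases e
      · exact h₀.symm
      · exact h₁.symm
    · simp only [Fin.mk_one, Fin.zero_eta] at h₀ h₁
      rw [← h₀, ← h₁, Fin.lt_def] at hlt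
      simp [pairPos] at hlt
    · exact absurd rfl hne
  choose π hπ using key
  have hinj : Function.Injective π := by
    intro j j' hjj
    have := (hπ j 0).trans (hjj ▸ (hπ j' 0).symm)
    exact (pairPos_injective2 (σ.injective this)).1
  refine ⟨Equiv.ofBijective π (Finite.injective_iff_bijective.1 hinj), ?_⟩
  ext1 c
  obtain ⟨j, e, rfl⟩ := exists_eq_pairPos c
  rw [ofPairs_pairPos, hπ, ofBijective_apply]

theorem ofPairs_mem_pairIncreasing {n : ℕ} (π : Perm (Fin n)) : ofPairs π ∈ pairIncreasing n := by
  rw [mem_pairIncreasing]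
  intro j
  rw [ofPairs_pairPos, ofPairs_pairPos, Fin.lt_def]
  simp [pairPos]

theorem keepsPair_ofPairs {n : ℕ} (π : Perm (Fin n)) (t : Fin n) : KeepsPair (ofPairs π) t := by
  have : ∀ e, (ofPairs π)⁻¹ (pairPos t e) = pairPos (π⁻¹ t) e := by
    intro e
    rw [Perm.inv_eq_iff_eq, ofPairs_pairPos, ← Perm.mul_apply, mul_inv_cancel, Perm.one_apply]
  rw [KeepsPair, this, this, pairEquiv_symm_pairPos, pairEquiv_symm_pairPos]

theorem ofPairs_injective {n : ℕ} : Function.Injective (ofPairs (n := n)) := by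
  intro π π' h
  ext1 j
  have := congrArg (fun σ => σ (pairPos j 0)) h
  simp only [ofPairs_pairPos] at this
  exact (pairPos_injective2 this).1

/-- The Pfaffian of the array with all entries `1` above the diagonal is `1`, in the normalisation
that counts every perfect matching `n!` times. Exchanging the letters `2t, 2t + 1` for the least `t`
such that they do not form a consecutive pair is a sign-reversing involution, and the permutations
without such a `t` are the even permutations that move the consecutive pairs. -/
theorem sum_sign_pairIncreasing (n : ℕ) :
    ∑ σ ∈ pairIncreasing n, (Perm.sign σ : ℤ) = n.factorial := by
  classical
  rw [← Finset.sum_filter_add_sum_filter_not (pairIncreasing n) (fun σ => ∀ t, KeepsPair σ t)]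
  have h1 : (pairIncreasing n).filter (fun σ => ∀ t, KeepsPair σ t) =
      Finset.univ.image (ofPairs (n := n)) := by
    ext σ
    simp only [Finset.mem_filter, Finset.mem_image, Finset.mem_univ, true_and]
    constructor
    · exact fun h => exists_ofPairs_eq h.1 h.2
    · rintro ⟨π, rfl⟩
      exact ⟨ofPairs_mem_pairIncreasing π, keepsPair_ofPairs π⟩
  rw [h1, Finset.sum_image ofPairs_injective.injOn]
  have h2 : ∑ π : Perm (Fin n), ((Perm.sign (ofPairs π) : ℤˣ) : ℤ) = n.factorial := by
    simp [sign_ofPairs, Fintype.card_perm]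
  rw [h2, add_eq_left]
  rcases n with _ | n
  · refine Finset.sum_eq_zero fun σ hσ => ?_
    exact absurd (fun t => t.elim0) (Finset.mem_filter.1 hσ).2
  have hex : ∀ σ : Perm (Fin (2 * (n + 1))), ¬ (∀ t, KeepsPair σ t) →
      ∃ t, ¬ KeepsPair σ t ∧ ∀ t' < t, KeepsPair σ t' := by
    intro σ hσ
    obtain ⟨t, ht, hmin⟩ := WellFounded.has_min (r := ((· < ·) : Fin (n + 1) → Fin (n + 1) → Prop))
      wellFounded_lt {t | ¬ KeepsPair σ t} (not_forall.1 hσ)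
    exact ⟨t, ht, fun t' ht' => not_not.1 fun h => hmin t' h ht'⟩
  choose! T hT hTmin using hex
  have hTeq : ∀ σ, (¬ ∀ t, KeepsPair σ t) → T (swapPair (T σ) * σ) = T σ := by
    intro σ hσ
    have hσ' : ¬ ∀ t, KeepsPair (swapPair (T σ) * σ) t := by
      simpa only [keepsPair_swapPair_mul] using hσ
    have a := hT _ hσ'
    have b := hTmin _ hσ'
    simp only [keepsPair_swapPair_mul] at a b
    rcases lt_trichotomy (T (swapPair (T σ) * σ)) (T σ) with h | h | h
    · exact absurd (hTmin _ hσ _ h) a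
    · exact h
    · exact absurd (b _ h) (hT _ hσ)
  refine Finset.sum_involution (fun σ _ => swapPair (T σ) * σ) ?_ ?_ ?_ ?_
  · intro σ hσ
    have : Perm.sign (swapPair (T σ)) = -1 :=
      Perm.sign_swap fun h => absurd (pairPos_injective2 h).2 (by decide)
    simp [Perm.sign_mul, this]
  · intro σ hσ _ h
    have : swapPair (T σ) = 1 := mul_eq_right.1 h
    rw [swapPair, swap_eq_one_iff] at this
    exact absurd (pairPos_injective2 this).2 (by decide)
  · intro σ hσ
    rw [Finset.mem_filter] at hσ ⊢
    refine ⟨swapPair_mul_mem_pairIncreasing hσ.1 (hT _ hσ.2), ?_⟩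
    simpa only [keepsPair_swapPair_mul] using hσ.2
  · intro σ hσ
    rw [Finset.mem_filter] at hσ
    simp only [hTeq σ hσ.2]
    rw [← mul_assoc, swapPair, swap_mul_self, one_mul]

/-- The reversal of `2n` letters reverses the consecutive pairs and exchanges the letters within
each of them. -/
theorem sign_revPerm_two_mul (n : ℕ) :
    Perm.sign (Fin.revPerm : Perm (Fin (2 * n))) = (-1) ^ n := by
  have h : (Fin.revPerm : Perm (Fin (2 * n))) =
      ofPairs Fin.revPerm * withinPairs fun _ => swap 0 1 := by
    ext1 c
    obtain ⟨j, e, rfl⟩ := exists_eq_pairPos c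
    rw [Perm.mul_apply, withinPairs_pairPos, ofPairs_pairPos]
    fin_cases e <;> ext <;> simp [pairPos] <;> omega
  rw [h, Perm.sign_mul, sign_ofPairs, sign_withinPairs, one_mul]
  simp

/-! ### Convergence of the series -/

/-- The neighbourhoods of `0` contain open ideals, which are open additive subgroups. -/
theorem IsLinearTopology.nonarchimedeanRing (R : Type*) [CommRing R] [TopologicalSpace R]
    [IsTopologicalRing R] [IsLinearTopology R R] : NonarchimedeanRing R where
  is_nonarchimedean U hU := by
    obtain ⟨I, hI, hIU⟩ := (IsLinearTopology.hasBasis_open_ideal (R := R)).mem_iff.1 hU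
    exact ⟨⟨I.toAddSubgroup, hI⟩, hIU⟩

/-- In a nonarchimedean ring, a product of finitely many convergent series is the sum of all the
products of their terms. -/
theorem HasSum.prod_of_nonarchimedean {R : Type*} [CommRing R] [TopologicalSpace R]
    [NonarchimedeanRing R] {ι : Type*} {n : ℕ} {f : Fin n → ι → R} {a : Fin n → R}
    (h : ∀ j, HasSum (f j) (a j)) : HasSum (fun k : Fin n → ι => ∏ j, f j (k j)) (∏ j, a j) := by
  let _ : UniformSpace R := IsTopologicalAddGroup.rightUniformSpace R
  have : IsUniformAddGroup R := isUniformAddGroup_of_addCommGroup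
  induction n with
  | zero =>
    simpa only [Finset.univ_eq_empty, Finset.prod_empty] using
      hasSum_unique (fun k : Fin 0 → ι => ∏ j, f j (k j))
  | succ n ih =>
    have h' := (h 0).mul_of_nonarchimedean (ih fun j => h j.succ)
    rw [Fin.prod_univ_succ, ← (Fin.consEquiv fun _ => ι).hasSum_iff]
    simpa [Function.comp_def, Fin.prod_univ_succ, Fin.consEquiv] using h'

/-- A family of power series is summable if only finitely many of them have order at most `D`, for
every `D`. -/
theorem MvPowerSeries.summable_of_finite_order_le {σ K ι : Type*} [CommRing K]
    [TopologicalSpace K] {f : ι → MvPowerSeries σ K}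
    (h : ∀ D : ℕ, {i | (f i).order ≤ D}.Finite) : Summable f := by
  rw [MvPowerSeries.WithPiTopology.summable_iff_summable_coeff]
  intro d
  refine summable_of_hasFiniteSupport ((h d.degree).subset ?_)
  intro i hi
  exact MvPowerSeries.order_le hi

theorem order_completeFunction (K : Type*) [Field K] (k : ℤ) :
    (k.toNat : ℕ∞) ≤ (completeFunction K k).order := by
  refine MvPowerSeries.nat_le_order fun d hd => ?_
  change (if (d.degree : ℤ) = k then (1 : K) else 0) = 0
  rw [if_neg]
  omega

theorem MvPowerSeries.order_le_order_rename {σ τ K : Type*} [CommRing K] (e : σ ↪ τ)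
    (f : MvPowerSeries σ K) : f.order ≤ (MvPowerSeries.rename e f).order := by
  refine MvPowerSeries.le_order fun d hd => ?_
  by_cases h : d ∈ Set.range (Finsupp.mapDomain e)
  · obtain ⟨d, rfl⟩ := h
    rw [← Finsupp.embDomain_eq_mapDomain] at hd ⊢
    rw [MvPowerSeries.coeff_embDomain_rename]
    refine MvPowerSeries.coeff_of_lt_order (lt_of_le_of_lt (le_of_eq ?_) hd)
    rw [Finsupp.embDomain_eq_mapDomain, Finsupp.degree_mapDomain]
  · exact MvPowerSeries.coeff_rename_eq_zero _ _ h

theorem order_hIn (K : Type*) [Field K] {r : ℕ} (s : Fin r) (k : ℤ) :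
    (k.toNat : ℕ∞) ≤ (hIn K s k).order :=
  (order_completeFunction K k).trans (MvPowerSeries.order_le_order_rename _ _)

theorem MvPowerSeries.order_le_order_prod {σ K ι : Type*} [CommRing K] [Fintype ι]
    (f : ι → MvPowerSeries σ K) (i : ι) : (f i).order ≤ (∏ j, f j).order :=
  (Finset.single_le_sum (f := fun j => (f j).order) (fun _ _ => zero_le) (Finset.mem_univ i)).trans
    (MvPowerSeries.le_order_prod _ _)

/-- Already the first factor `h_{k-i₁}(x^{(1)})` has order at least `k - n`. -/
theorem summable_evenTerm (K : Type*) [Field K] [TopologicalSpace K] {m n : ℕ} (hm : 0 < m)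
    (i : Fin (2 * m) → Fin n) : Summable (evenTerm K i) := by
  refine MvPowerSeries.summable_of_finite_order_le fun D => ?_
  refine (Set.finite_Iic (D + n)).subset fun k hk => ?_
  have h := ((order_hIn K ⟨0, by omega⟩ _).trans (MvPowerSeries.order_le_order_prod
    (fun s : Fin (2 * m) => hIn K s ((k : ℤ) - ((i s : ℕ) + 1))) ⟨0, by omega⟩)).trans hk
  rw [Nat.cast_le] at h
  have := (i ⟨0, by omega⟩).isLt
  rw [Set.mem_Iic]
  omega

theorem MvPowerSeries.le_order_sub {σ K : Type*} [CommRing K] {f g : MvPowerSeries σ K} {N : ℕ∞}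
    (hf : N ≤ f.order) (hg : N ≤ g.order) : N ≤ (f - g).order := by
  rw [sub_eq_add_neg]
  exact (le_min hf (by rwa [MvPowerSeries.order_neg])).trans MvPowerSeries.min_order_le_add

/-- Both products in the first of the `2 × 2` determinants have a factor `h_{k+l+1-i}` with `i ≤ 2n`,
so the term has order at least `k + l + 1 - 2n`. -/
theorem summable_oddTerm (K : Type*) [Field K] [TopologicalSpace K] {m n : ℕ} (hm : 0 < m)
    (i : Fin m → Fin 2 → Fin (2 * n)) : Summable (oddTerm K i) := by
  refine MvPowerSeries.summable_of_finite_order_le fun D => ?_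
  refine ((Set.finite_Iic (D + 2 * n)).prod (Set.finite_Iic (D + 2 * n))).subset fun p hp => ?_
  have h := (MvPowerSeries.order_le_order_prod (fun s : Fin m => Matrix.det
    !![hIn K s ((p.1 : ℤ) + p.2 + 1 - ((i s 0 : ℕ) + 1)), hIn K s ((p.2 : ℤ) - ((i s 0 : ℕ) + 1));
       hIn K s ((p.1 : ℤ) + p.2 + 1 - ((i s 1 : ℕ) + 1)), hIn K s ((p.2 : ℤ) - ((i s 1 : ℕ) + 1))])
    ⟨0, hm⟩).trans hp
  have h0 := (i ⟨0, hm⟩ 0).isLt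
  have h1 := (i ⟨0, hm⟩ 1).isLt
  have h2 : ((p.1 + p.2 - 2 * n : ℕ) : ℕ∞) ≤ D := by
    refine le_trans ?_ h
    rw [Matrix.det_fin_two_of]
    refine MvPowerSeries.le_order_sub ?_ ?_ <;> refine le_trans ?_ MvPowerSeries.le_order_mul
    · refine le_trans ?_ (le_add_right (order_hIn _ _ _))
      rw [Nat.cast_le]
      omega
    · refine le_trans ?_ (le_add_left (order_hIn _ _ _))
      rw [Nat.cast_le]
      omega
  rw [Nat.cast_le] at h2
  rw [Set.mem_prod, Set.mem_Iic, Set.mem_Iic]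
  omega

/-- The permutations `τ s` permute the rows of the `2 × 2` determinants. -/
theorem oddTerm_perm (K : Type*) [Field K] {m n : ℕ} (τ : Fin m → Equiv.Perm (Fin 2))
    (i : Fin m → Fin 2 → Fin (2 * n)) (p : ℕ × ℕ) :
    oddTerm K (fun s e => i s (τ s e)) p =
      (∏ s, ((Equiv.Perm.sign (τ s) : ℤ) : MvPowerSeries (Fin m × ℕ) K)) * oddTerm K i p := by
  rw [oddTerm, oddTerm, ← Finset.prod_mul_distrib]
  refine Finset.prod_congr rfl fun s _ => ?_
  rw [← Matrix.det_permute]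
  congr 1
  ext1 a b
  fin_cases a <;> fin_cases b <;> simp <;> generalize τ s _ = e <;> fin_cases e <;> rfl

theorem isPairAlternating_tsum_oddTerm (K : Type*) [Field K] [TopologicalSpace K]
    [DiscreteTopology K] {m n : ℕ} (hm : 0 < m) :
    IsPairAlternating
      (fun i : Fin m → Fin 2 → Fin (2 * n) => ∑' p : ℕ × ℕ, oddTerm K i p) := by
  intro τ i
  simp only [oddTerm_perm]
  exact (summable_oddTerm K hm i).tsum_mul_left _

/-! ### The Jacobi–Trudi formula -/

theorem coeff_completeFunction (K : Type*) [Field K] (k : ℤ) (d : ℕ →₀ ℕ) :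
    MvPowerSeries.coeff d (completeFunction K k) = if (d.degree : ℤ) = k then 1 else 0 := rfl

/-- The power series obtained by setting the variables `x_N, x_{N+1}, …` to `0`: only the monomials
in `x₀, …, x_{N-1}` are kept. -/
noncomputable def restrictVarsFun {K : Type*} [Field K] (N : ℕ) (f : MvPowerSeries ℕ K) :
    MvPowerSeries ℕ K :=
  fun d => if ∀ i ∈ d.support, i < N then MvPowerSeries.coeff d f else 0

theorem coeff_restrictVarsFun {K : Type*} [Field K] (N : ℕ) (f : MvPowerSeries ℕ K) (d : ℕ →₀ ℕ) :
    MvPowerSeries.coeff d (restrictVarsFun N f) =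
      if ∀ i ∈ d.support, i < N then MvPowerSeries.coeff d f else 0 := rfl

/-- Setting the variables `x_N, x_{N+1}, …` to `0`, as a ring homomorphism. -/
noncomputable def restrictVars (K : Type*) [Field K] (N : ℕ) :
    MvPowerSeries ℕ K →+* MvPowerSeries ℕ K where
  toFun := restrictVarsFun N
  map_one' := by
    ext d
    rw [coeff_restrictVarsFun, MvPowerSeries.coeff_one, ite_eq_left_iff]
    intro h
    rw [if_neg]
    rintro rfl
    simp at h
  map_zero' := by
    ext d
    simp [coeff_restrictVarsFun]
  map_add' f g := by
    ext d
    simp only [coeff_restrictVarsFun, map_add]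
    split_ifs <;> simp
  map_mul' f g := by
    ext d
    rw [coeff_restrictVarsFun, MvPowerSeries.coeff_mul, MvPowerSeries.coeff_mul]
    simp only [coeff_restrictVarsFun]
    split_ifs with h
    · refine Finset.sum_congr rfl fun p hp => ?_
      rw [Finset.HasAntidiagonal.mem_antidiagonal] at hp
      subst hp
      have hs : ∀ i, p.1 i + p.2 i ≠ 0 → i < N := by
        intro i hi
        exact h i (by simpa using hi)
      rw [if_pos, if_pos]
      · exact fun i hi => hs i (by simp only [Finsupp.mem_support_iff] at hi; omega)
      · exact fun i hi => hs i (by simp only [Finsupp.mem_support_iff] at hi; omega)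
    · refine (Finset.sum_eq_zero fun p hp => ?_).symm
      rw [Finset.HasAntidiagonal.mem_antidiagonal] at hp
      subst hp
      by_contra hne
      have h1 := of_not_not (mt (fun h => if_neg h) (left_ne_zero_of_mul hne))
      have h2 := of_not_not (mt (fun h => if_neg h) (right_ne_zero_of_mul hne))
      refine h fun i hi => ?_
      rw [Finsupp.mem_support_iff, Finsupp.add_apply] at hi
      by_cases hi1 : p.1 i = 0
      · exact h2 i (Finsupp.mem_support_iff.2 (by omega))
      · exact h1 i (Finsupp.mem_support_iff.2 hi1)

theorem coeff_restrictVars (K : Type*) [Field K] (N : ℕ) (f : MvPowerSeries ℕ K) (d : ℕ →₀ ℕ) :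
    MvPowerSeries.coeff d (restrictVars K N f) =
      if ∀ i ∈ d.support, i < N then MvPowerSeries.coeff d f else 0 := rfl

theorem completeFunction_of_neg (K : Type*) [Field K] {k : ℤ} (hk : k < 0) :
    completeFunction K k = 0 := by
  ext d
  rw [coeff_completeFunction, if_neg (by omega), map_zero]

theorem completeFunction_zero (K : Type*) [Field K] : completeFunction K 0 = 1 := by
  classical
  ext d
  rw [coeff_completeFunction, MvPowerSeries.coeff_one]
  simp [Finsupp.degree_eq_zero_iff]

/-- The recurrence `h_k(x₀, …, x_N) = h_k(x₀, …, x_{N-1}) + x_N h_{k-1}(x₀, …, x_N)`. -/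
theorem restrictVars_succ_completeFunction (K : Type*) [Field K] (N : ℕ) (k : ℤ) :
    restrictVars K (N + 1) (completeFunction K k) = restrictVars K N (completeFunction K k) +
      MvPowerSeries.X N * restrictVars K (N + 1) (completeFunction K (k - 1)) := by
  ext d
  rw [map_add, MvPowerSeries.X_def, MvPowerSeries.coeff_monomial_mul]
  simp only [coeff_restrictVars, coeff_completeFunction, one_mul]
  by_cases hN : d N = 0
  · rw [if_neg (show ¬ Finsupp.single N 1 ≤ d by simp [hN]), add_zero]
    refine if_congr ?_ rfl rfl
    refine forall₂_congr fun i hi => ?_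
    have : i ≠ N := by
      rintro rfl
      exact (Finsupp.mem_support_iff.1 hi) hN
    omega
  · have hle : Finsupp.single N 1 ≤ d := by
      rw [Finsupp.single_le_iff]
      omega
    obtain ⟨e, rfl⟩ := exists_add_of_le hle
    have hsupp : ¬ ∀ i ∈ (Finsupp.single N 1 + e).support, i < N :=
      fun h => lt_irrefl N (h N (Finsupp.mem_support_iff.2 hN))
    rw [if_neg hsupp, if_pos hle, zero_add, add_tsub_cancel_left]
    refine if_congr ?_ (if_congr ?_ rfl rfl) rfl
    · constructor
      · intro h i hi
        refine h i ?_
        simp only [Finsupp.mem_support_iff, Finsupp.add_apply] at hi ⊢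
        omega
      · intro h i hi
        by_cases hiN : i = N
        · omega
        · refine h i ?_
          simpa [Finsupp.single_apply, Ne.symm hiN] using hi
    · rw [map_add, Finsupp.degree_single]
      push_cast
      omega

theorem restrictVars_zero_completeFunction (K : Type*) [Field K] {k : ℕ} (hk : k ≠ 0) :
    restrictVars K 0 (completeFunction K k) = 0 := by
  classical
  ext d
  rw [coeff_restrictVars, coeff_completeFunction]
  split_ifs with h h'
  · have : d = 0 := by
      ext i
      by_contra hi
      exact absurd (h i (Finsupp.mem_support_iff.2 hi)) (by omega)
    subst this
    simp only [map_zero, Nat.cast_zero] at h'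
    omega
  · rfl
  · rfl

/-- The generating function `∑ h_k(x₀, …, x_{N-1}) tᵏ` is the inverse of `∏ (1 - xᵢ t)`. -/
theorem mk_restrictVars_mul_prod (K : Type*) [Field K] (N : ℕ) :
    (PowerSeries.mk fun k : ℕ => restrictVars K N (completeFunction K k)) *
      ∏ i ∈ Finset.range N, (1 - PowerSeries.C (MvPowerSeries.X i) * PowerSeries.X) = 1 := by
  induction N with
  | zero =>
    ext k : 1
    rw [Finset.range_zero, Finset.prod_empty, mul_one, PowerSeries.coeff_mk, PowerSeries.coeff_one]
    split_ifs with h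
    · rw [h, Nat.cast_zero, completeFunction_zero, map_one]
    · exact restrictVars_zero_completeFunction K h
  | succ N ih =>
    rw [Finset.prod_range_succ, mul_comm (∏ i ∈ Finset.range N, _), ← mul_assoc]
    refine Eq.trans ?_ ih
    congr 1
    ext k : 1
    rw [mul_sub, mul_one, mul_comm (PowerSeries.C _), ← mul_assoc, map_sub, PowerSeries.coeff_mul_C,
      PowerSeries.coeff_mk, PowerSeries.coeff_mk, restrictVars_succ_completeFunction]
    rcases k with _ | k
    · rw [PowerSeries.coeff_zero_mul_X, completeFunction_of_neg K (k := _ - 1) (by simp)]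
      simp
    · rw [PowerSeries.coeff_succ_mul_X, PowerSeries.coeff_mk]
      push_cast
      rw [add_sub_cancel_right]
      ring

/-- The polynomial `∏_{i ≠ r} (1 - xᵢ t)` in `t`, where `i` runs over `0, …, N - 1`. -/
noncomputable def prodOmit (K : Type*) [Field K] (N r : ℕ) : Polynomial (MvPowerSeries ℕ K) :=
  ∏ i ∈ (Finset.range N).erase r, (1 - Polynomial.C (MvPowerSeries.X i) * Polynomial.X)

theorem natDegree_prodOmit_lt (K : Type*) [Field K] {N r : ℕ} (hr : r < N) :
    (prodOmit K N r).natDegree < N := by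
  have h : ∀ i ∈ (Finset.range N).erase r, (1 - Polynomial.C (MvPowerSeries.X i) * Polynomial.X :
      Polynomial (MvPowerSeries ℕ K)).natDegree ≤ 1 := by
    intro i _
    compute_degree
  have h' := (Polynomial.natDegree_prod_le _ _).trans (Finset.sum_le_card_nsmul _ _ _ h)
  rw [Finset.card_erase_of_mem (Finset.mem_range.2 hr), Finset.card_range] at h'
  rw [prodOmit]
  simp only [smul_eq_mul, mul_one] at h'
  omega

/-- `H(t) ∏_{i ≠ r} (1 - xᵢ t) = 1 / (1 - x_r t)`, coefficient by coefficient. -/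
theorem sum_coeff_prodOmit_mul (K : Type*) [Field K] {N r : ℕ} (hr : r < N) (a : ℕ) :
    ∑ q ∈ Finset.range N,
        (prodOmit K N r).coeff q * restrictVars K N (completeFunction K ((a : ℤ) - q)) =
      MvPowerSeries.X r ^ a := by
  set H : PowerSeries (MvPowerSeries ℕ K) :=
    PowerSeries.mk fun k : ℕ => restrictVars K N (completeFunction K k) with hH
  have h1 : (prodOmit K N r : PowerSeries (MvPowerSeries ℕ K)) * H *
      (1 - PowerSeries.C (MvPowerSeries.X r) * PowerSeries.X) = 1 := by
    refine Eq.trans ?_ (mk_restrictVars_mul_prod K N)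
    rw [← hH, ← Finset.mul_prod_erase _ _ (Finset.mem_range.2 hr),
      prodOmit, ← Polynomial.coeToPowerSeries.ringHom_apply, map_prod]
    simp only [map_sub, map_one, map_mul, Polynomial.coeToPowerSeries.ringHom_apply,
      Polynomial.coe_C, Polynomial.coe_X]
    ring
  have h2 : (PowerSeries.mk fun k => (MvPowerSeries.X r : MvPowerSeries ℕ K) ^ k) *
      (1 - PowerSeries.C (MvPowerSeries.X r) * PowerSeries.X) = 1 := by
    ext k : 1
    rw [mul_sub, mul_one, mul_comm (PowerSeries.C _), ← mul_assoc, map_sub, PowerSeries.coeff_mk]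
    rcases k with _ | k
    · simp
    · simp [PowerSeries.coeff_succ_mul_X, PowerSeries.coeff_one, pow_succ]
  have h3 : (prodOmit K N r : PowerSeries (MvPowerSeries ℕ K)) * H =
      PowerSeries.mk fun k => (MvPowerSeries.X r : MvPowerSeries ℕ K) ^ k := by
    calc _ = (prodOmit K N r : PowerSeries (MvPowerSeries ℕ K)) * H *
          ((PowerSeries.mk fun k => (MvPowerSeries.X r : MvPowerSeries ℕ K) ^ k) *
            (1 - PowerSeries.C (MvPowerSeries.X r) * PowerSeries.X)) := by rw [h2, mul_one]
      _ = (prodOmit K N r : PowerSeries (MvPowerSeries ℕ K)) * H *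
            (1 - PowerSeries.C (MvPowerSeries.X r) * PowerSeries.X) *
          (PowerSeries.mk fun k => (MvPowerSeries.X r : MvPowerSeries ℕ K) ^ k) := by ring
      _ = _ := by rw [h1, one_mul]
  have h4 := congrArg (PowerSeries.coeff a) h3
  rw [PowerSeries.coeff_mk, PowerSeries.coeff_mul, Finset.Nat.sum_antidiagonal_eq_sum_range_succ_mk]
    at h4
  rw [← h4]
  -- both sums are equal to the sum over all `q < N + a + 1`
  have e1 : ∑ q ∈ Finset.range N,
        (prodOmit K N r).coeff q * restrictVars K N (completeFunction K ((a : ℤ) - q)) =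
      ∑ q ∈ Finset.range (N + (a + 1)),
        (prodOmit K N r).coeff q * restrictVars K N (completeFunction K ((a : ℤ) - q)) := by
    refine Finset.sum_subset (Finset.range_mono (by omega)) fun q _ hq => ?_
    rw [Finset.mem_range, not_lt] at hq
    rw [Polynomial.coeff_eq_zero_of_natDegree_lt ((natDegree_prodOmit_lt K hr).trans_le hq),
      zero_mul]
  rw [e1]
  symm
  refine (Finset.sum_congr rfl fun q hq => ?_).trans
    (Finset.sum_subset (Finset.range_mono (show a + 1 ≤ N + (a + 1) by omega)) fun q _ hq => ?_)
  · rw [Finset.mem_range] at hq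
    rw [Polynomial.coeff_coe, hH, PowerSeries.coeff_mk, Nat.cast_sub (by omega)]
  · rw [Finset.mem_range] at hq
    rw [completeFunction_of_neg K (by omega), map_zero, mul_zero]

/-- The Jacobi–Trudi determinant `det (h_{μ_j - j + i})` of size `n`. -/
noncomputable def jacobiTrudi (K : Type*) [Field K] (n : ℕ) (μ : YoungDiagram) :
    MvPowerSeries ℕ K :=
  Matrix.det (Matrix.of fun i j : Fin n =>
    completeFunction K ((μ.rowLen j : ℤ) - (j : ℕ) + (i : ℕ)))

/-- If `μ` has at most `n` rows then the last column of the determinant of size `n + 1` is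
`(0, …, 0, 1)`. -/
theorem jacobiTrudi_succ (K : Type*) [Field K] {n : ℕ} {μ : YoungDiagram}
    (h : μ.rowLen n = 0) : jacobiTrudi K (n + 1) μ = jacobiTrudi K n μ := by
  rw [jacobiTrudi, Matrix.det_succ_column _ (Fin.last n), Fin.sum_univ_castSucc,
    Finset.sum_eq_zero, zero_add]
  · simp only [Matrix.of_apply, Fin.val_last, h]
    rw [Nat.cast_zero, zero_sub, neg_add_cancel, completeFunction_zero, Even.neg_one_pow ⟨n, rfl⟩,
      one_mul, one_mul, jacobiTrudi]
    congr 1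
    ext1 i j
    simp
  · intro i _
    rw [Matrix.of_apply, completeFunction_of_neg, mul_zero, zero_mul]
    simp [h]

theorem rowLen_eq_zero_of_colLen_le {μ : YoungDiagram} {n : ℕ} (h : μ.colLen 0 ≤ n) :
    μ.rowLen n = 0 := by
  by_contra hne
  have := YoungDiagram.mem_iff_lt_rowLen.2 (Nat.pos_of_ne_zero hne)
  rw [YoungDiagram.mem_iff_lt_colLen] at this
  omega

theorem jacobiTrudi_eq_of_colLen_le (K : Type*) [Field K] {n : ℕ} {μ : YoungDiagram}
    (h : μ.colLen 0 ≤ n) : jacobiTrudi K n μ = jacobiTrudi K (μ.colLen 0) μ := by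
  induction n, h using Nat.le_induction with
  | base => rfl
  | succ n hn ih => rw [jacobiTrudi_succ K (rowLen_eq_zero_of_colLen_le hn), ih]

/-- An alternant is the product of a determinant not depending on its exponents and of a
determinant of complete symmetric functions. -/
theorem coe_alternant (K : Type*) [Field K] {N : ℕ} (α : Fin N → ℕ) :
    (alternant K α : MvPowerSeries ℕ K) =
      Matrix.det (Matrix.of fun r i : Fin N => (prodOmit K N r).coeff (N - 1 - i)) *
      Matrix.det (Matrix.of fun i j : Fin N =>
        restrictVars K N (completeFunction K ((α j : ℤ) - ((N - 1 - i : ℕ) : ℤ)))) := by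
  rw [alternant, ← MvPolynomial.coeToMvPowerSeries.ringHom_apply, RingHom.map_det, ← Matrix.det_mul]
  congr 1
  ext1 r j
  rw [Matrix.mul_apply, RingHom.mapMatrix_apply, Matrix.map_apply, Matrix.of_apply, map_pow,
    MvPolynomial.coeToMvPowerSeries.ringHom_apply, MvPolynomial.coe_X,
    ← sum_coeff_prodOmit_mul K r.isLt, ← Finset.sum_range_reflect, Finset.sum_range]
  rfl

theorem coe_alternant_shiftedParts (K : Type*) [Field K] (N : ℕ) (μ : YoungDiagram) :
    (alternant K (shiftedParts N μ) : MvPowerSeries ℕ K) =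
      (alternant K (staircase N) : MvPowerSeries ℕ K) *
        restrictVars K N (jacobiTrudi K N μ) := by
  rw [coe_alternant, coe_alternant]
  -- for the staircase the second factor is unitriangular
  have h1 : Matrix.det (Matrix.of fun i j : Fin N => restrictVars K N
      (completeFunction K ((staircase N j : ℤ) - ((N - 1 - i : ℕ) : ℤ)))) = 1 := by
    rw [Matrix.det_of_isLowerTriangular]
    · refine Finset.prod_eq_one fun i _ => ?_
      rw [Matrix.of_apply, staircase, sub_self, completeFunction_zero, map_one]
    · intro i j hij
      have hij : i < j := hij
      rw [Matrix.of_apply, completeFunction_of_neg, map_zero]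
      rw [staircase]
      omega
  rw [h1, mul_one, jacobiTrudi, RingHom.map_det]
  congr 2
  ext1 i j
  rw [RingHom.mapMatrix_apply, Matrix.map_apply, Matrix.of_apply, Matrix.of_apply]
  congr 2
  rw [shiftedParts, staircase]
  omega

theorem alternant_staircase_ne_zero (K : Type*) [Field K] (N : ℕ) :
    alternant K (staircase N) ≠ 0 := by
  have h : Matrix.of (fun i j : Fin N => (MvPolynomial.X (i : ℕ) : MvPolynomial ℕ K) ^ staircase N j)
      = (Matrix.vandermonde fun i : Fin N => (MvPolynomial.X (i : ℕ) : MvPolynomial ℕ K)).submatrix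
        id Fin.revPerm := by
    ext1 i j
    rw [Matrix.submatrix_apply, Matrix.vandermonde_apply, Matrix.of_apply, staircase,
      Fin.revPerm_apply, Fin.val_rev]
    congr 1
    omega
  rw [alternant, h, Matrix.det_permute']
  refine mul_ne_zero ?_ (Matrix.det_vandermonde_ne_zero_iff.2 ?_)
  · rcases Int.units_eq_one_or (Equiv.Perm.sign (Fin.revPerm : Equiv.Perm (Fin N))) with h | h <;>
      simp [h]
  · exact (MvPolynomial.X_injective).comp Fin.val_injective

/-- The Jacobi–Trudi formula in `N` variables. -/
theorem coe_schurPoly (K : Type*) [Field K] (N : ℕ) (μ : YoungDiagram) :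
    (schurPoly K N μ : MvPowerSeries ℕ K) = restrictVars K N (jacobiTrudi K N μ) := by
  have h := coe_alternant_shiftedParts K N μ
  rw [schurPoly_spec, MvPolynomial.coe_mul] at h
  refine mul_left_cancel₀ ?_ h
  exact mt MvPolynomial.coe_eq_zero_iff.1 (alternant_staircase_ne_zero K N)

/-- The Jacobi–Trudi formula in infinitely many variables. The size `n` of the determinant is
independent of the number of variables that is used for a given coefficient, because the determinant
does not change when `n ≥ ℓ(μ)` grows. -/
theorem schurFunction_eq_jacobiTrudi (K : Type*) [Field K] {n : ℕ} {μ : YoungDiagram}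
    (h : μ.colLen 0 ≤ n) : schurFunction K μ = jacobiTrudi K n μ := by
  rw [jacobiTrudi_eq_of_colLen_le K h]
  ext d
  set N := max (μ.colLen 0) (d.support.sup (· + 1)) with hN
  have h1 : MvPowerSeries.coeff d (schurFunction K μ) = (schurPoly K N μ).coeff d := rfl
  rw [h1, ← MvPolynomial.coeff_coe, coe_schurPoly, coeff_restrictVars,
    jacobiTrudi_eq_of_colLen_le K (le_max_left _ _), if_pos]
  intro i hi
  exact (Finset.le_sup (f := (· + 1)) hi).trans (le_max_right _ _)

/-! ### Sequences of distinct positive numbers and partitions -/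

theorem shiftedParts_strictAnti (n : ℕ) (μ : YoungDiagram) : StrictAnti (shiftedParts n μ) := by
  intro i j hij
  have h := μ.rowLen_anti i j hij.le
  have hij' : (i : ℕ) < j := hij
  simp only [shiftedParts, staircase]
  omega

theorem shiftedParts_injective {n : ℕ} {μ ν : YoungDiagram} (hμ : μ.colLen 0 ≤ n)
    (hν : ν.colLen 0 ≤ n) (h : shiftedParts n μ = shiftedParts n ν) : μ = ν := by
  have hrow : ∀ i, μ.rowLen i = ν.rowLen i := by
    intro i
    by_cases hi : i < n
    · have := congrFun h ⟨i, hi⟩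
      simpa [shiftedParts] using this
    · have h1 := μ.rowLen_anti n i (not_lt.1 hi)
      have h2 := ν.rowLen_anti n i (not_lt.1 hi)
      rw [rowLen_eq_zero_of_colLen_le hμ] at h1
      rw [rowLen_eq_zero_of_colLen_le hν] at h2
      omega
  ext ⟨i, j⟩
  rw [YoungDiagram.mem_cells, YoungDiagram.mem_cells, YoungDiagram.mem_iff_lt_rowLen,
    YoungDiagram.mem_iff_lt_rowLen, hrow]

/-- Between two places a strictly decreasing sequence of natural numbers drops at least by their
distance. -/
theorem StrictAnti.val_add_le {n : ℕ} {w : Fin n → ℕ} (hw : StrictAnti w) {i j : Fin n}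
    (hij : i ≤ j) : w j + j ≤ w i + i := by
  have h := Finset.card_le_card_of_injOn w (s := Finset.Icc i j) (t := Finset.Icc (w j) (w i))
    (fun k hk => by
      rw [Finset.coe_Icc, Set.mem_Icc] at hk
      rw [Finset.coe_Icc, Set.mem_Icc]
      exact ⟨hw.antitone hk.2, hw.antitone hk.1⟩) hw.injective.injOn
  rw [Fin.card_Icc, Nat.card_Icc] at h
  have h1 : w j ≤ w i := hw.antitone hij
  have h2 : (i : ℕ) ≤ j := hij
  omega

theorem exists_shiftedParts_eq {n : ℕ} {w : Fin n → ℕ} (hw : StrictAnti w) :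
    ∃ μ : PartitionOfLengthLE n, shiftedParts n μ.1 = w := by
  have hsort : (List.ofFn fun i => w i - staircase n i).SortedGE := by
    rw [List.sortedGE_ofFn_iff]
    intro i j hij
    have h1 := hw.val_add_le hij
    have h2 : (i : ℕ) ≤ j := hij
    simp only [staircase]
    omega
  refine ⟨⟨YoungDiagram.ofRowLens _ hsort, ?_⟩, ?_⟩
  · by_contra hlt
    rw [not_le, ← YoungDiagram.mem_iff_lt_colLen, YoungDiagram.mem_ofRowLens] at hlt
    obtain ⟨h, -⟩ := hlt
    simp at h
  · ext i
    have h := YoungDiagram.rowLen_ofRowLens (hw := hsort) ⟨i, by simp⟩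
    have hi := i.isLt
    have h1 := hw.val_add_le (i := i) (j := ⟨n - 1, by omega⟩) (Fin.le_def.2 (Nat.le_sub_one_of_lt hi))
    rw [shiftedParts]
    simp only [List.getElem_ofFn, Fin.getElem_fin] at h
    rw [h]
    change w i - (n - 1 - (i : ℕ)) + (n - 1 - (i : ℕ)) = w i
    simp only at h1
    omega

/-- The sequence with pairwise distinct positive entries which consists of the numbers
`μ_j + n - j + 1` (`1 ≤ j ≤ n`), arranged by a permutation. -/
def arrangedParts (n : ℕ) (x : PartitionOfLengthLE n × Equiv.Perm (Fin n)) : Fin n → ℕ :=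
  fun j => shiftedParts n x.1.1 (x.2 j) + 1

theorem arrangedParts_injective (n : ℕ) : Function.Injective (arrangedParts n) := by
  rintro ⟨⟨μ, hμ⟩, π⟩ ⟨⟨ν, hν⟩, ρ⟩ h
  have h1 : shiftedParts n μ ∘ π = shiftedParts n ν ∘ ρ := by
    ext j
    exact Nat.succ_injective (congrFun h j)
  have h2 : shiftedParts n μ = shiftedParts n ν := by
    refine ((shiftedParts_strictAnti n μ).range_inj (shiftedParts_strictAnti n ν)).1 ?_
    rw [← π.surjective.range_comp (shiftedParts n μ), h1, ρ.surjective.range_comp]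
  obtain rfl := shiftedParts_injective hμ hν h2
  congr 1
  ext1 j
  exact (shiftedParts_strictAnti n μ).injective (congrFun h1 j)

/-- Sorting `v` decreasingly and subtracting the staircase and `1` gives the partition; the
permutation is the inverse of the sorting one. -/
theorem exists_arrangedParts_eq {n : ℕ} {v : Fin n → ℕ} (hv : Function.Injective v)
    (hpos : ∀ j, v j ≠ 0) : ∃ x, arrangedParts n x = v := by
  have hmono : StrictMono (v ∘ Tuple.sort v) :=
    (Tuple.monotone_sort v).strictMono_of_injective (hv.comp (Tuple.sort v).injective)
  have hw : StrictAnti fun i => v (Tuple.sort v (Fin.rev i)) - 1 := by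
    intro i j hij
    have h1 : v (Tuple.sort v (Fin.rev j)) < v (Tuple.sort v (Fin.rev i)) :=
      hmono (Fin.rev_lt_rev.2 hij)
    have h2 := hpos (Tuple.sort v (Fin.rev j))
    simp only
    omega
  obtain ⟨μ, hμ⟩ := exists_shiftedParts_eq hw
  refine ⟨(μ, (Tuple.sort v).symm.trans Fin.revPerm), ?_⟩
  ext j
  have h2 := hpos j
  simp only [arrangedParts, hμ, Equiv.trans_apply, Fin.revPerm_apply, Fin.rev_rev,
    Equiv.apply_symm_apply]
  omega

/-- A convergent sum over all sequences of natural numbers whose terms vanish unless the entries are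
positive and pairwise distinct is a sum over partitions. -/
theorem HasSum.arrangedParts {R : Type*} [AddCommGroup R] [TopologicalSpace R]
    [IsTopologicalAddGroup R] {n : ℕ} {g : (Fin n → ℕ) → R} {a : R} (h : HasSum g a)
    (hinj : ∀ v, ¬ Function.Injective v → g v = 0) (hpos : ∀ v j, v j = 0 → g v = 0) :
    HasSum (fun μ : PartitionOfLengthLE n =>
      ∑ π : Equiv.Perm (Fin n), g (arrangedParts n (μ, π))) a := by
  have h1 : HasSum (g ∘ _root_.arrangedParts n) a := by
    refine ((arrangedParts_injective n).hasSum_iff fun v hv => ?_).2 h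
    by_contra hne
    refine hv (exists_arrangedParts_eq ?_ ?_)
    · exact not_not.1 fun hi => hne (hinj v hi)
    · exact fun j hj => hne (hpos v j hj)
  exact h1.prod_fiberwise fun μ => hasSum_fintype _

/-! ### The hyperdeterminant and hyperpfaffian formulas -/

/-- The determinant `det (h_{v_j - i}(x^{(s)}))` (`1 ≤ i, j ≤ n`). -/
noncomputable def completeDet (K : Type*) [Field K] {r n : ℕ} (s : Fin r) (v : Fin n → ℕ) :
    MvPowerSeries (Fin r × ℕ) K :=
  Matrix.det (Matrix.of fun i j : Fin n => hIn K s ((v j : ℤ) - ((i : ℕ) + 1)))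

theorem completeDet_of_not_injective (K : Type*) [Field K] {r n : ℕ} (s : Fin r) {v : Fin n → ℕ}
    (hv : ¬ Function.Injective v) : completeDet K s v = 0 := by
  rw [Function.not_injective_iff] at hv
  obtain ⟨i, j, hij, hne⟩ := hv
  refine Matrix.det_zero_of_column_eq hne fun k => ?_
  rw [Matrix.of_apply, Matrix.of_apply, hij]

theorem completeDet_of_eq_zero (K : Type*) [Field K] {r n : ℕ} (s : Fin r) {v : Fin n → ℕ}
    {j : Fin n} (hj : v j = 0) : completeDet K s v = 0 := by
  refine Matrix.det_eq_zero_of_column_eq_zero j fun i => ?_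
  rw [Matrix.of_apply, hj, hIn, inAlphabet, completeFunction_of_neg, map_zero]
  omega

/-- The Jacobi–Trudi formula for `completeDet`: the row `i` of `completeDet` is the row `n + 1 - i` of
the Jacobi–Trudi determinant, whence the sign of the reversal of `n` letters. -/
theorem completeDet_arrangedParts (K : Type*) [Field K] {r n : ℕ} (s : Fin r)
    (μ : PartitionOfLengthLE n) (π : Perm (Fin n)) :
    completeDet K s (arrangedParts n (μ, π)) =
      ((Perm.sign π : ℤ) : MvPowerSeries (Fin r × ℕ) K) *
        (((Perm.sign (Fin.revPerm : Perm (Fin n)) : ℤ) : MvPowerSeries (Fin r × ℕ) K) *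
          inAlphabet s (schurFunction K μ.1)) := by
  have h : inAlphabet s (schurFunction K μ.1) = Matrix.det (Matrix.of fun i j : Fin n =>
      hIn K s ((μ.1.rowLen j : ℤ) - (j : ℕ) + (i : ℕ))) := by
    rw [schurFunction_eq_jacobiTrudi K μ.2, jacobiTrudi, inAlphabet, AlgHom.map_det]
    rfl
  rw [h, ← Matrix.det_permute, ← Matrix.det_permute']
  rw [completeDet]
  congr 1
  ext1 i j
  simp only [Matrix.of_apply, Matrix.submatrix_apply, id, arrangedParts, shiftedParts, staircase,
    Fin.revPerm_apply, Fin.val_rev]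
  congr 1
  have := (π j).isLt
  omega

/-- The products of series in the hyperdeterminant are expanded into one sum over all sequences, and
the sum over the permutations `σ s` is then a product of determinants. -/
theorem hasSum_hdet (K : Type*) [Field K] [TopologicalSpace K] [DiscreteTopology K] {m : ℕ}
    (n : ℕ) (hm : 0 < m) :
    HasSum (fun v : Fin n → ℕ => ((n.factorial : K)⁻¹) • ∏ s : Fin (2 * m), completeDet K s v)
      (hdet K m n fun i => ∑' k : ℕ, evenTerm K i k) := by
  have : NonarchimedeanRing (MvPowerSeries (Fin (2 * m) × ℕ) K) :=
    IsLinearTopology.nonarchimedeanRing _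
  have h : ∀ v : Fin n → ℕ, ∏ s : Fin (2 * m), completeDet K s v =
      ∑ σ : Fin (2 * m) → Perm (Fin n),
        (∏ s, ((Perm.sign (σ s) : ℤ) : MvPowerSeries (Fin (2 * m) × ℕ) K)) *
          ∏ j : Fin n, evenTerm K (fun s => σ s j) (v j) := by
    intro v
    simp only [completeDet, Matrix.det_apply', Finset.prod_univ_sum, Fintype.piFinset_univ,
      Finset.prod_mul_distrib, evenTerm, Matrix.of_apply]
    refine Finset.sum_congr rfl fun σ _ => ?_
    rw [Finset.prod_comm]
  simp only [h]
  exact HasSum.const_smul _ (hasSum_sum fun σ _ => HasSum.mul_left _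
    (HasSum.prod_of_nonarchimedean fun j => (summable_evenTerm K hm _).hasSum))

theorem Int.units_cast_pow_even {R : Type*} [CommRing R] (u : ℤˣ) {m : ℕ} (hm : Even m) :
    ((u : ℤ) : R) ^ m = 1 := by
  rcases Int.units_eq_one_or u with h | h <;> simp [h, hm]

theorem Int.units_cast_pow_odd {R : Type*} [CommRing R] (u : ℤˣ) {m : ℕ} (hm : Odd m) :
    ((u : ℤ) : R) ^ m = ((u : ℤ) : R) := by
  rcases Int.units_eq_one_or u with h | h <;> simp [h, hm]

theorem inv_factorial_smul (K : Type*) [Field K] [CharZero K] {R : Type*} [CommRing R] [Algebra K R]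
    (n : ℕ) (x : R) : ((n.factorial : K)⁻¹) • ((n.factorial : R) * x) = x := by
  rw [← nsmul_eq_mul, ← Nat.cast_smul_eq_nsmul K, smul_smul, inv_mul_cancel₀, one_smul]
  exact_mod_cast n.factorial_ne_zero

theorem hasSum_schurFunction_hdet (K : Type*) [Field K] [CharZero K] [TopologicalSpace K]
    [DiscreteTopology K] (n : ℕ) {m : ℕ} (hm : 0 < m) :
    HasSum (fun μ : PartitionOfLengthLE n =>
        ∏ s : Fin (2 * m), inAlphabet s (schurFunction K μ.1))
      (hdet K m n fun i => ∑' k : ℕ, evenTerm K i k) := by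
  have h0 : ∀ v : Fin n → ℕ, (∃ s : Fin (2 * m), completeDet K s v = 0) →
      ((n.factorial : K)⁻¹) • ∏ s : Fin (2 * m), completeDet K s v = 0 := by
    rintro v ⟨s, hs⟩
    rw [Finset.prod_eq_zero (Finset.mem_univ s) hs, smul_zero]
  have h := (hasSum_hdet K n hm).arrangedParts
    (fun v hv => h0 v ⟨⟨0, by omega⟩, completeDet_of_not_injective K _ hv⟩)
    (fun v j hj => h0 v ⟨⟨0, by omega⟩, completeDet_of_eq_zero K _ hj⟩)
  refine h.congr_fun fun μ => ?_
  simp only [completeDet_arrangedParts, Finset.prod_mul_distrib, Finset.prod_const,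
    Finset.card_univ, Fintype.card_fin, Int.units_cast_pow_even _ (even_two_mul m), one_mul,
    Fintype.card_perm, Finset.sum_const]
  rw [smul_comm, nsmul_eq_mul]
  exact (inv_factorial_smul K n _).symm

/-- The sequence `(k₁ + l₁ + 1, l₁, …, k_n + l_n + 1, l_n)`. -/
def pairTuple {n : ℕ} (p : Fin n → ℕ × ℕ) : Fin (2 * n) → ℕ := fun c =>
  ![(p ((pairEquiv n).symm c).1).1 + (p ((pairEquiv n).symm c).1).2 + 1,
    (p ((pairEquiv n).symm c).1).2] ((pairEquiv n).symm c).2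

theorem pairTuple_zero {n : ℕ} (p : Fin n → ℕ × ℕ) (j : Fin n) :
    pairTuple p (pairPos j 0) = (p j).1 + (p j).2 + 1 := by
  simp [pairTuple]

theorem pairTuple_one {n : ℕ} (p : Fin n → ℕ × ℕ) (j : Fin n) :
    pairTuple p (pairPos j 1) = (p j).2 := by
  simp [pairTuple]

theorem pairTuple_injective (n : ℕ) : Function.Injective (pairTuple (n := n)) := by
  intro p q h
  ext1 j
  have h0 := congrFun h (pairPos j 0)
  have h1 := congrFun h (pairPos j 1)
  rw [pairTuple_zero, pairTuple_zero] at h0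
  rw [pairTuple_one, pairTuple_one] at h1
  ext <;> omega

theorem exists_pairTuple_eq {n : ℕ} {v : Fin (2 * n) → ℕ}
    (hv : ∀ j : Fin n, v (pairPos j 1) < v (pairPos j 0)) : ∃ p, pairTuple p = v := by
  refine ⟨fun j => (v (pairPos j 0) - v (pairPos j 1) - 1, v (pairPos j 1)), ?_⟩
  ext c
  obtain ⟨j, e, rfl⟩ := exists_eq_pairPos c
  have := hv j
  fin_cases e
  · simp only [Fin.zero_eta, pairTuple_zero]
    omega
  · simp only [Fin.mk_one, pairTuple_one]

/-- The analogue of `hasSum_hdet`, with the Laplace expansion along pairs of columns in place of the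
expansion of a determinant. -/
theorem hasSum_hpf (K : Type*) [Field K] [TopologicalSpace K] [DiscreteTopology K] {m : ℕ}
    (n : ℕ) (hm : 0 < m) :
    HasSum (fun p : Fin n → ℕ × ℕ =>
        ((n.factorial : K)⁻¹) • ∏ s : Fin m, completeDet K s (pairTuple p))
      (hpf K m n fun i => ∑' p : ℕ × ℕ, oddTerm K i p) := by
  have : NonarchimedeanRing (MvPowerSeries (Fin m × ℕ) K) :=
    IsLinearTopology.nonarchimedeanRing _
  have h : ∀ p : Fin n → ℕ × ℕ, ∏ s : Fin m, completeDet K s (pairTuple p) =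
      ∑ σ ∈ Fintype.piFinset fun _ : Fin m => pairIncreasing n,
        (∏ s, ((Perm.sign (σ s) : ℤ) : MvPowerSeries (Fin m × ℕ) K)) *
          ∏ j : Fin n, oddTerm K (fun s e => σ s (pairPos j e)) (p j) := by
    intro p
    simp only [completeDet, ← sum_pairIncreasing_prod_det, Finset.prod_univ_sum,
      Finset.prod_mul_distrib, oddTerm, Matrix.of_apply]
    refine Finset.sum_congr rfl fun σ _ => ?_
    rw [Finset.prod_comm]
    congr 1
    refine Finset.prod_congr rfl fun j _ => Finset.prod_congr rfl fun s _ => ?_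
    simp only [Matrix.det_fin_two, Matrix.of_apply, Matrix.cons_val_zero, Matrix.cons_val_one,
      pairTuple_zero, pairTuple_one, Matrix.cons_val', Matrix.cons_val_fin_one]
    push_cast
    rfl
  simp only [h]
  exact HasSum.const_smul _ (hasSum_sum fun σ _ => HasSum.mul_left _
    (HasSum.prod_of_nonarchimedean fun j => (summable_oddTerm K hm _).hasSum))

theorem hasSum_schurFunction_hpf (K : Type*) [Field K] [CharZero K] [TopologicalSpace K]
    [DiscreteTopology K] (n : ℕ) {m : ℕ} (hm : Odd m) :
    HasSum (fun μ : PartitionOfLengthLE (2 * n) =>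
        ∏ s : Fin m, inAlphabet s (schurFunction K μ.1))
      ((-1) ^ n * hpf K m n fun i => ∑' p : ℕ × ℕ, oddTerm K i p) := by
  set g : (Fin (2 * n) → ℕ) → MvPowerSeries (Fin m × ℕ) K := fun v =>
    if ∀ j : Fin n, v (pairPos j 1) < v (pairPos j 0) then
      ((n.factorial : K)⁻¹) • ∏ s : Fin m, completeDet K s v else 0 with hg
  -- the sum over the pairs `(k_j, l_j)` as a sum over all sequences of length `2n`
  have h1 : HasSum g (hpf K m n fun i => ∑' p : ℕ × ℕ, oddTerm K i p) := by
    rw [← (pairTuple_injective n).hasSum_iff]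
    · convert hasSum_hpf K n hm.pos using 2 with p
      refine if_pos fun j => ?_
      rw [pairTuple_zero, pairTuple_one]
      omega
    · exact fun v hv => if_neg fun hlt => hv (exists_pairTuple_eq hlt)
  have h2 : ∀ v, (∃ s : Fin m, completeDet K s v = 0) → g v = 0 := by
    rintro v ⟨s, hs⟩
    rw [hg]
    simp only [Finset.prod_eq_zero (f := fun s => completeDet K s v) (Finset.mem_univ s) hs,
      smul_zero, ite_self]
  have h3 := h1.arrangedParts
    (fun v hv => h2 v ⟨⟨0, hm.pos⟩, completeDet_of_not_injective K _ hv⟩)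
    (fun v j hj => h2 v ⟨⟨0, hm.pos⟩, completeDet_of_eq_zero K _ hj⟩)
  refine (h3.mul_left ((-1) ^ n)).congr_fun fun μ => ?_
  -- `μ_j + 2n - j + 1` decreases strictly, so `π` has to increase on every consecutive pair
  have hcond : ∀ π : Perm (Fin (2 * n)), (∀ j : Fin n, arrangedParts (2 * n) (μ, π) (pairPos j 1) <
      arrangedParts (2 * n) (μ, π) (pairPos j 0)) ↔ π ∈ pairIncreasing n := by
    intro π
    rw [mem_pairIncreasing]
    refine forall_congr' fun j => ?_
    rw [arrangedParts, arrangedParts, Nat.add_lt_add_iff_right,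
      (shiftedParts_strictAnti (2 * n) μ.1).lt_iff_gt]
  simp only [hg, hcond, completeDet_arrangedParts, Finset.prod_mul_distrib, Finset.prod_const,
      Finset.card_univ, Fintype.card_fin, Int.units_cast_pow_odd _ hm, sign_revPerm_two_mul]
  rw [Finset.sum_ite_mem, Finset.univ_inter, ← Finset.smul_sum, ← Finset.sum_mul, ← Int.cast_sum,
    sum_sign_pairIncreasing, Int.cast_natCast, inv_factorial_smul, ← mul_assoc]
  push_cast
  rw [← mul_pow, neg_mul_neg, one_mul, one_pow, one_mul]

theorem theorem3p4 (K : Type*) [Field K] [CharZero K] [TopologicalSpace K] [DiscreteTopology K]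
    (n : ℕ) :
    (∀ m : ℕ, 0 < m →
      (∀ i : Fin (2 * m) → Fin n, Summable (evenTerm K i)) ∧
      HasSum
        (fun μ : PartitionOfLengthLE n =>
          ∏ s : Fin (2 * m), inAlphabet s (schurFunction K μ.1))
        (hdet K m n fun i => ∑' k : ℕ, evenTerm K i k)) ∧
    (∀ m : ℕ, Odd m →
      (∀ i : Fin m → Fin 2 → Fin (2 * n), Summable (oddTerm K i)) ∧
      IsPairAlternating
        (fun i : Fin m → Fin 2 → Fin (2 * n) => ∑' p : ℕ × ℕ, oddTerm K i p) ∧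
      HasSum
        (fun μ : PartitionOfLengthLE (2 * n) =>
          ∏ s : Fin m, inAlphabet s (schurFunction K μ.1))
        ((-1) ^ n * hpf K m n fun i => ∑' p : ℕ × ℕ, oddTerm K i p)) :=
  ⟨fun _ hm => ⟨summable_evenTerm K hm, hasSum_schurFunction_hdet K n hm⟩,
    fun _ hm => ⟨summable_oddTerm K hm.pos, isPairAlternating_tsum_oddTerm K hm.pos,
      hasSum_schurFunction_hpf K n hm⟩⟩
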